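/- Let $n \geq 1$, let $X_1, \ldots, X_n$ be i.i.d. $\mathrm{Unif}[0,1]$ random variables, let $K(x) = \frac{1}{\sqrt{2\pi}} e^{-x^2/2}$ be the Gaussian kernel, and let $h \in (0,1]$, $a \in (0,1/4]$ and $\delta \in (0,1/2)$. For $x \in [a, 1-a]$ define the kernel density estimator $$\hat g(x) = \frac{1}{n} \sum_{i=1}^n \frac{1}{h} K\left(\frac{X_i - x}{h}\right)$$ and set $S(x) = \hat g(x) - \mathbb{E}[\hat g(x)]$. Let $N = \left\lfloor 1 + \frac{1-2a}{\delta} \right\rfloor$, let $x_j = a + (j-1)\delta$ for $1 \leq j \leq N$, and let $\Sigma \in \mathbb{R}^{N \times N}$ be the scaled covariance matrix with entries $\Sigma_{ij} = n h\, \mathrm{Cov}[S(x_i), S(x_j)]$. Then the minimum eigenvalue of $\Sigma$ satisfies $$\lambda_{\min}(\Sigma) \leq 2 e^{-h^2/\delta^2} + \frac{h}{\pi a \delta} e^{-a^2/h^2}.$$ -/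

import Mathlib

open MeasureTheory ProbabilityTheory

noncomputable section

namespace KDE

/-- The Gaussian kernel `K(x) = exp(-x² / 2) / √(2π)`. -/
def gaussKernel (x : ℝ) : ℝ := 1 / Real.sqrt (2 * Real.pi) * Real.exp (-x ^ 2 / 2)

/-- The rescaled kernel `K_h(u) = K(u / h) / h`. -/
def scaledKernel (h u : ℝ) : ℝ := 1 / h * gaussKernel (u / h)

/-- The kernel density estimator `ĝ(x) = (1/n) ∑ᵢ K_h(Xᵢ - x)`, as a random variable. -/
def kde {Ω : Type*} {n : ℕ} (X : Fin n → Ω → ℝ) (h x : ℝ) (ω : Ω) : ℝ :=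
  1 / (n : ℝ) * ∑ i : Fin n, scaledKernel h (X i ω - x)

/-- The centered process `S(x) = ĝ(x) - E[ĝ(x)]`. -/
def centeredKde {Ω : Type*} [MeasurableSpace Ω] (P : Measure Ω) {n : ℕ} (X : Fin n → Ω → ℝ)
    (h x : ℝ) (ω : Ω) : ℝ :=
  kde X h x ω - ∫ ω', kde X h x ω' ∂P

/-- The number of mesh points, `N = ⌊1 + (1 - 2a) / δ⌋`. -/
def meshSize (a δ : ℝ) : ℕ := ⌊1 + (1 - 2 * a) / δ⌋₊

/-- The mesh points `a + (j - 1) δ`, `1 ≤ j ≤ N`; here `j` is counted from `0`. -/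
def meshPoint (a δ : ℝ) (j : Fin (meshSize a δ)) : ℝ := a + (j : ℝ) * δ

/-- The scaled covariance matrix `Σ = n h Var[S(𝒳_δ)]` of the process at the mesh points. -/
def scaledCov {Ω : Type*} [MeasurableSpace Ω] (P : Measure Ω) {n : ℕ} (X : Fin n → Ω → ℝ)
    (h a δ : ℝ) : Matrix (Fin (meshSize a δ)) (Fin (meshSize a δ)) ℝ :=
  Matrix.of fun i j =>
    (n : ℝ) * h * covariance (centeredKde P X h (meshPoint a δ i))
      (centeredKde P X h (meshPoint a δ j)) P

/-- `μ` is the minimum eigenvalue of the real square matrix `A`. -/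
def IsMinEigenvalue {N : ℕ} (A : Matrix (Fin N) (Fin N) ℝ) (μ : ℝ) : Prop :=
  IsLeast {t : ℝ | Module.End.HasEigenvalue (Matrix.toLin' A) t} μ

end KDE

end

/-! The minimum eigenvalue is at most the quadratic form at any vector `v` of norm at least one, so
one good test vector suffices. With `φ = ∑ v i * K_h(· - x i)`, the form of `Σ` at `v` is `n h`
times the variance of the empirical mean of `φ`. Discarding the squared mean and enlarging `[0,1]`
to the line bounds it by `h ∫ φ²`, a form in the Gaussian Toeplitz matrix `exp (-c (i - j)²) /
(2√π)` with `c = δ² / (4h²)` (`KDE.scaledCov_form_le`).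

Up to diagonal scaling that matrix is the Vandermonde matrix `r ^ (i j)`, `r = exp (2c)`. Taking for
`v` the rescaled coefficients of the polynomial with roots `r ^ k`, `k < m = N - 1`, kills every row
but the last and leaves `∏ (1 - r ^ (-k))`, `1 ≤ k ≤ m` (`exists_gaussian_toeplitz_form_eq`). By `1
- x ≤ exp (-x)` and a Riemann sum this is exponentially small. Whether `2cN` exceeds one decides
which term of the bound dominates it (`half_inv_sqrt_pi_mul_prod_le`). -/

/-! ### Minimum eigenvalue and quadratic form -/

/-- A real symmetric matrix of positive size has a minimum eigenvalue, and it is bounded by the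
quadratic form at any vector with an entry equal to one. -/
theorem exists_isMinEigenvalue_le {N : ℕ} {A : Matrix (Fin N) (Fin N) ℝ} (hA : A.IsHermitian)
    (v : Fin N → ℝ) (i₀ : Fin N) (hv : v i₀ = 1) {B : ℝ} (hB : 0 ≤ B)
    (hvB : ∑ i, ∑ j, v i * v j * A i j ≤ B) :
    ∃ μ, KDE.IsMinEigenvalue A μ ∧ μ ≤ B := by
  obtain ⟨i₁, -, hi₁⟩ := Finset.exists_min_image Finset.univ hA.eigenvalues ⟨i₀, Finset.mem_univ _⟩
  have hset : {t : ℝ | Module.End.HasEigenvalue (Matrix.toLin' A) t} = Set.range hA.eigenvalues := by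
    rw [← hA.spectrum_real_eq_range_eigenvalues]
    ext t
    rw [Set.mem_ofPred_eq, Module.End.hasEigenvalue_iff_mem_spectrum, Matrix.spectrum_toLin']
  refine ⟨hA.eigenvalues i₁, ?_, ?_⟩
  · rw [KDE.IsMinEigenvalue, hset]
    exact ⟨⟨i₁, rfl⟩, by rintro _ ⟨j, rfl⟩; exact hi₁ j (Finset.mem_univ _)⟩
  · set μ := hA.eigenvalues i₁
    have hpsd : (A - algebraMap ℝ _ μ).PosSemidef := by
      rw [Matrix.posSemidef_iff_isHermitian_and_spectrum_nonneg]
      constructor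
      · refine hA.sub ?_
        rw [Matrix.algebraMap_eq_diagonal]
        exact Matrix.isHermitian_diagonal _
      · rw [← spectrum.sub_singleton_eq, hA.spectrum_real_eq_range_eigenvalues]
        rintro _ ⟨_, ⟨j, rfl⟩, _, rfl, rfl⟩
        exact sub_nonneg.2 (hi₁ j (Finset.mem_univ _))
    have h1 := hpsd.dotProduct_mulVec_nonneg v
    rw [Matrix.sub_mulVec, dotProduct_sub] at h1
    have h2 : star v ⬝ᵥ A.mulVec v = ∑ i, ∑ j, v i * v j * A i j := by
      simp only [dotProduct, Matrix.mulVec, Finset.mul_sum, star_trivial]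
      exact Finset.sum_congr rfl fun i _ => Finset.sum_congr rfl fun j _ => by ring
    have h3 : star v ⬝ᵥ (algebraMap ℝ (Matrix (Fin N) (Fin N) ℝ) μ).mulVec v = μ * ∑ i, v i ^ 2 := by
      simp only [Matrix.algebraMap_eq_diagonal, dotProduct, Matrix.mulVec_diagonal, star_trivial,
        Finset.mul_sum]
      exact Finset.sum_congr rfl fun i _ => by simp; ring
    rw [h2, h3] at h1
    have h4 : 1 ≤ ∑ i, v i ^ 2 := by
      have := Finset.single_le_sum (f := fun i => v i ^ 2) (fun i _ => sq_nonneg (v i))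
        (Finset.mem_univ i₀)
      simpa [hv] using this
    -- Only for `μ > 0` does `∑ v i ^ 2 ≥ 1` give `μ ≤ μ * ∑ v i ^ 2`; otherwise `0 ≤ B` is what
    -- concludes.
    rcases le_or_gt μ 0 with h | h
    · exact h.trans hB
    · nlinarith

/-! ### The test vector for the Gaussian Toeplitz matrix -/

/-- An explicit vector with last entry one at which the quadratic form of the Gaussian Toeplitz
matrix `exp (-c (i - j) ^ 2)` is a `q`-factorial. -/
theorem exists_gaussian_toeplitz_form_eq (c : ℝ) (m : ℕ) :
    ∃ v : ℕ → ℝ, v m = 1 ∧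
      ∑ i ∈ Finset.range (m + 1), ∑ j ∈ Finset.range (m + 1),
        v i * v j * Real.exp (-c * ((i : ℝ) - j) ^ 2) =
      ∏ k ∈ Finset.range m, (1 - Real.exp (-(2 * c * ((k : ℝ) + 1)))) := by
  classical
  set r : ℝ := Real.exp (2 * c) with hr
  set Q : Polynomial ℝ := ∏ k ∈ Finset.range m, (Polynomial.X - Polynomial.C (r ^ k)) with hQ
  have hmonic : Q.Monic := Polynomial.monic_prod_of_monic _ _ fun k _ => Polynomial.monic_X_sub_C _
  have hdeg : Q.natDegree = m := by
    rw [hQ, Polynomial.natDegree_prod_of_monic _ _ fun k _ => Polynomial.monic_X_sub_C (r ^ k)]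
    simp only [Polynomial.natDegree_X_sub_C, Finset.sum_const, Finset.card_range, smul_eq_mul,
      mul_one]
  set C : ℝ := Real.exp (-c * (m : ℝ) ^ 2) with hC
  have hcoeff : Q.coeff m = 1 := by rw [← hdeg]; exact hmonic
  have hrow : ∀ j ≤ m, ∑ i ∈ Finset.range (m + 1), Q.coeff i * (r ^ j) ^ i =
      ∏ k ∈ Finset.range m, (r ^ j - r ^ k) := by
    intro j _
    rw [← hdeg, ← Polynomial.eval_eq_sum_range, hdeg, hQ, Polynomial.eval_prod]
    simp
  have hker : ∀ i j : ℕ, Real.exp (-c * ((i : ℝ) - j) ^ 2) =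
      Real.exp (-c * (i : ℝ) ^ 2) * Real.exp (-c * (j : ℝ) ^ 2) * (r ^ j) ^ i := by
    intro i j
    rw [hr, ← Real.exp_nat_mul, ← Real.exp_nat_mul, ← Real.exp_add, ← Real.exp_add]
    congr 1; ring
  -- The factor `exp (c i²)` cancels the diagonal scaling in `hker`; `C` makes the last entry one.
  refine ⟨fun i => C * Q.coeff i * Real.exp (c * (i : ℝ) ^ 2), ?_, ?_⟩
  · simp only [hcoeff, mul_one, hC]
    rw [← Real.exp_add]; simp
  · have hterm : ∀ i j : ℕ, (C * Q.coeff i * Real.exp (c * (i : ℝ) ^ 2)) *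
        (C * Q.coeff j * Real.exp (c * (j : ℝ) ^ 2)) * Real.exp (-c * ((i : ℝ) - j) ^ 2) =
        C ^ 2 * Q.coeff j * (Q.coeff i * (r ^ j) ^ i) := by
      intro i j
      have e : ∀ x : ℝ, Real.exp (c * x) * Real.exp (-c * x) = 1 := fun x => by
        rw [← Real.exp_add]; simp
      rw [hker]
      linear_combination (C ^ 2 * Q.coeff i * Q.coeff j * (r ^ j) ^ i) *
        (Real.exp (c * (j : ℝ) ^ 2) * Real.exp (-c * (j : ℝ) ^ 2) * e ((i : ℝ) ^ 2) +
          e ((j : ℝ) ^ 2))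
    simp only [hterm]
    rw [Finset.sum_comm]
    simp only [← Finset.mul_sum]
    -- Row `j` contributes a multiple of `Q(r ^ j)`, which vanishes for `j < m`.
    rw [Finset.sum_eq_single m]
    · rw [hrow m le_rfl, hcoeff, mul_one]
      -- `C ^ 2` is split evenly over the `m` factors of `Q(r ^ m)`, which are then matched in
      -- reverse order.
      have hC2 : C ^ 2 = ∏ k ∈ Finset.range m, Real.exp (-(2 * c * m)) := by
        rw [Finset.prod_const, Finset.card_range, hC, ← Real.exp_nat_mul, ← Real.exp_nat_mul]
        congr 1; push_cast; ring
      rw [hC2, ← Finset.prod_mul_distrib, ← Finset.prod_range_reflect]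
      refine Finset.prod_congr rfl fun k hk => ?_
      have hk' : k < m := Finset.mem_range.1 hk
      have : ((m - 1 - k : ℕ) : ℝ) = (m : ℝ) - 1 - k := by
        rw [Nat.sub_sub, Nat.cast_sub (by omega)]; push_cast; ring
      rw [mul_sub, hr, ← Real.exp_nat_mul, ← Real.exp_nat_mul, ← Real.exp_add, ← Real.exp_add, this]
      congr 1
      · rw [← Real.exp_zero]; congr 1; ring
      · congr 1; ring
    · intro j hj hjm
      have hj' : j < m := lt_of_le_of_ne (Nat.lt_succ_iff.1 (Finset.mem_range.1 hj)) hjm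
      rw [hrow j hj'.le, Finset.prod_eq_zero (Finset.mem_range.2 hj') (sub_self _), mul_zero]
    · simp

/-! ### Estimates for the `q`-factorial -/

/-- The left side telescopes, and `1 - exp (-y) ≤ y` bounds each increment; for `y > 0` this
compares an integral with a left Riemann sum. -/
theorem exp_sub_exp_le_mul_sum_exp {y : ℝ} (m : ℕ) :
    Real.exp (-y) - Real.exp (-((m + 1) * y)) ≤
      y * ∑ k ∈ Finset.range m, Real.exp (-(y * ((k : ℝ) + 1))) := by
  induction m with
  | zero => simp
  | succ m ih =>
    rw [Finset.sum_range_succ, mul_add]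
    have h1 : Real.exp (-(((m + 1 : ℕ) + 1 : ℝ) * y)) =
        Real.exp (-(y * ((m : ℝ) + 1))) * Real.exp (-y) := by
      rw [← Real.exp_add]; push_cast; congr 1; ring
    have h2 : Real.exp (-((m + 1) * y)) = Real.exp (-(y * ((m : ℝ) + 1))) := by congr 1; ring
    rw [h1]; rw [h2] at ih
    have h3 := Real.add_one_le_exp (-y)
    have := Real.exp_pos (-(y * ((m : ℝ) + 1)))
    nlinarith

/-- With `z = (m + 1) y`, the `q`-factorial is at most `exp (1 - (1 - exp (-z)) / y)`. -/
theorem prod_one_sub_exp_le {y : ℝ} (hy : 0 < y) (m : ℕ) :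
    ∏ k ∈ Finset.range m, (1 - Real.exp (-(y * ((k : ℝ) + 1)))) ≤
      Real.exp (1 - (1 - Real.exp (-((m + 1) * y))) / y) := by
  calc _ ≤ ∏ k ∈ Finset.range m, Real.exp (-Real.exp (-(y * ((k : ℝ) + 1)))) := by
        refine Finset.prod_le_prod (fun k _ => ?_) fun k _ => Real.one_sub_le_exp_neg _
        rw [sub_nonneg, Real.exp_le_one_iff]
        have : 0 ≤ y * ((k : ℝ) + 1) := by positivity
        linarith
    _ = Real.exp (-∑ k ∈ Finset.range m, Real.exp (-(y * ((k : ℝ) + 1)))) := by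
        rw [← Real.exp_sum, Finset.sum_neg_distrib]
    _ ≤ _ := by
        rw [Real.exp_le_exp]
        have h1 := exp_sub_exp_le_mul_sum_exp (y := y) m
        -- The sum starts at `exp (-y)` rather than `1`; the loss, at most `y`, becomes the summand
        -- `1` in the exponent.
        have h2 := Real.one_sub_le_exp_neg y
        have h3 : (1 - Real.exp (-((m + 1) * y))) / y - 1 ≤
            ∑ k ∈ Finset.range m, Real.exp (-(y * ((k : ℝ) + 1))) := by
          rw [sub_le_iff_le_add, div_le_iff₀ hy]
          linarith
        linarith

/-- Comparison of the `q`-factorial bound with the two exponential terms. -/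
theorem half_inv_sqrt_pi_mul_prod_le {t s b : ℝ} (ht : 0 < t) {m : ℕ} (hm : 1 ≤ m)
    (hb : 0 < b) (hb' : b ≤ 1 / 4) (hs0 : 0 ≤ s) (hs : 2 * s * t ≤ m + 1) :
    1 / (2 * Real.sqrt Real.pi) *
      ∏ k ∈ Finset.range m, (1 - Real.exp (-(1 / (2 * t ^ 2) * ((k : ℝ) + 1)))) ≤
    2 * Real.exp (-t ^ 2) + t / (Real.pi * b) * Real.exp (-s ^ 2) := by
  set y : ℝ := 1 / (2 * t ^ 2) with hy
  have hy0 : 0 < y := by positivity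
  have hyinv : 1 / y = 2 * t ^ 2 := by rw [hy]; field_simp
  set z : ℝ := (m + 1) * y with hz
  have hz0 : 0 < z := by positivity
  -- The prefactor `1/3` absorbs the factor `exp 1 ≤ 3` coming from that summand.
  have hsqrt : 1 / (2 * Real.sqrt Real.pi) ≤ 1 / 3 := by
    apply one_div_le_one_div_of_le (by norm_num)
    have : (3 / 2 : ℝ) ≤ Real.sqrt Real.pi := by
      apply Real.le_sqrt_of_sq_le
      nlinarith [Real.pi_gt_three]
    linarith
  have hsqrt0 : 0 ≤ 1 / (2 * Real.sqrt Real.pi) := by positivity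
  have hP := prod_one_sub_exp_le hy0 m
  rw [← hz] at hP
  have he : Real.exp 1 ≤ 3 := by linarith [Real.exp_one_lt_d9]
  have hbound : ∀ w : ℝ, w * y ≤ 1 - Real.exp (-z) → 1 / (2 * Real.sqrt Real.pi) *
      ∏ k ∈ Finset.range m, (1 - Real.exp (-(y * ((k : ℝ) + 1)))) ≤ Real.exp (-w) := by
    intro w hw
    have h1 : w ≤ (1 - Real.exp (-z)) / y := (le_div_iff₀ hy0).2 hw
    have h2 : ∏ k ∈ Finset.range m, (1 - Real.exp (-(y * ((k : ℝ) + 1)))) ≤ 3 * Real.exp (-w) := by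
      calc _ ≤ Real.exp (1 + -w) := hP.trans (Real.exp_le_exp.2 (by linarith))
        _ = Real.exp 1 * Real.exp (-w) := Real.exp_add _ _
        _ ≤ _ := by gcongr
    calc _ ≤ 1 / (2 * Real.sqrt Real.pi) * (3 * Real.exp (-w)) := by gcongr
      _ ≤ 1 / 3 * (3 * Real.exp (-w)) := by gcongr
      _ = _ := by ring
  -- For `z ≥ 1`, `1 - exp (-z) ≥ 1/2 = t² y` yields the first term. For `z ≤ 1`, `1 - exp (-z) ≥
  -- z²/2 ≥ s² y` yields the second.
  rcases le_total 1 z with h1 | h1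
  · have h2 : Real.exp (-z) ≤ 1 / 2 := by
      have h4 : Real.exp (-z) ≤ Real.exp (-1) := Real.exp_le_exp.2 (by linarith)
      have : Real.exp (-1) ≤ 1 / 2 := by linarith [Real.exp_neg_one_lt_d9]
      linarith
    have h3 := hbound (t ^ 2) (by rw [hy]; field_simp; linarith)
    have : 0 ≤ t / (Real.pi * b) * Real.exp (-s ^ 2) := by positivity
    have := Real.exp_pos (-t ^ 2)
    rw [show -(t ^ 2) = -t ^ 2 from rfl] at h3
    linarith
  · have h2 : z ^ 2 / 2 ≤ 1 - Real.exp (-z) := by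
      have h5 := Real.exp_bound_div_one_sub_of_interval hz0.le
      have h4 : (1 + z) * Real.exp (-z) ≤ 1 := by
        have := Real.add_one_le_exp z
        calc _ ≤ Real.exp z * Real.exp (-z) := by gcongr; linarith
          _ = 1 := by rw [← Real.exp_add]; simp
      have : (1 + z) * (1 - z ^ 2 / 2) ≥ 1 := by nlinarith [mul_nonneg hz0.le (sub_nonneg.2 h1)]
      nlinarith
    have hsw : s ^ 2 * y ≤ z ^ 2 / 2 := by
      have h6 : s ≤ t * z := by
        rw [hz, hy]
        have : t * ((m + 1) * (1 / (2 * t ^ 2))) = (m + 1) / (2 * t) := by field_simp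
        rw [this, le_div_iff₀ (by positivity)]
        linarith
      have h7 : s ^ 2 ≤ (t * z) ^ 2 := by gcongr
      have h8 : (t * z) ^ 2 * y = z ^ 2 / 2 := by rw [hy]; field_simp
      calc _ ≤ (t * z) ^ 2 * y := by gcongr
        _ = _ := h8
    have h3 := hbound (s ^ 2) (hsw.trans h2)
    rw [show -(s ^ 2) = -s ^ 2 from rfl] at h3
    have hm' : (1 : ℝ) ≤ m := by exact_mod_cast hm
    -- As `m ≥ 1`, `2y ≤ z ≤ 1`; this keeps the coefficient of the second term at least one.
    have ht1 : 1 ≤ t := by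
      have : 2 * y ≤ 1 := by nlinarith
      have h9 : 2 * y = 1 / t ^ 2 := by rw [hy]; field_simp
      rw [h9, div_le_one (by positivity)] at this
      nlinarith
    have hcoef : 1 ≤ t / (Real.pi * b) := by
      rw [le_div_iff₀ (by positivity)]
      nlinarith [Real.pi_lt_four, Real.pi_pos]
    have := Real.exp_pos (-t ^ 2)
    have h10 := Real.exp_pos (-s ^ 2)
    nlinarith

/-! ### Products of Gaussian kernels -/

theorem KDE.continuous_scaledKernel (h : ℝ) : Continuous (KDE.scaledKernel h) := by
  unfold KDE.scaledKernel KDE.gaussKernel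
  fun_prop

theorem KDE.abs_scaledKernel_le (h u : ℝ) :
    |KDE.scaledKernel h u| ≤ |1 / h| * (1 / Real.sqrt (2 * Real.pi)) := by
  unfold KDE.scaledKernel KDE.gaussKernel
  rw [abs_mul, abs_mul, Real.abs_exp, abs_of_nonneg (by positivity : 0 ≤ 1 / √(2 * Real.pi))]
  gcongr
  refine mul_le_of_le_one_right (by positivity) ?_
  rw [Real.exp_le_one_iff, neg_div]
  have : 0 ≤ (u / h) ^ 2 / 2 := by positivity
  linarith

/-- Completing the square: `(u - x)² + (u - y)² = 2 (u - (x + y)/2)² + (x - y)²/2`. -/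
theorem KDE.scaledKernel_mul_scaledKernel {h : ℝ} (hh : 0 < h) (x y u : ℝ) :
    KDE.scaledKernel h (u - x) * KDE.scaledKernel h (u - y) =
      1 / (2 * Real.pi * h ^ 2) * Real.exp (-(x - y) ^ 2 / (4 * h ^ 2)) *
        Real.exp (-(1 / h ^ 2) * (u - (x + y) / 2) ^ 2) := by
  unfold KDE.scaledKernel KDE.gaussKernel
  have h1 : Real.exp (-((u - x) / h) ^ 2 / 2) * Real.exp (-((u - y) / h) ^ 2 / 2) =
      Real.exp (-(x - y) ^ 2 / (4 * h ^ 2)) *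
        Real.exp (-(1 / h ^ 2) * (u - (x + y) / 2) ^ 2) := by
    rw [← Real.exp_add, ← Real.exp_add]
    congr 1; field_simp; ring
  have h2 : 1 / Real.sqrt (2 * Real.pi) * (1 / Real.sqrt (2 * Real.pi)) = 1 / (2 * Real.pi) := by
    rw [div_mul_div_comm, Real.mul_self_sqrt (by positivity), one_mul]
  rw [mul_assoc (1 / (2 * Real.pi * h ^ 2)), ← h1]
  rw [show 1 / (2 * Real.pi * h ^ 2) = 1 / h * (1 / h) * (1 / (2 * Real.pi)) by field_simp, ← h2]
  ring

theorem KDE.integrable_scaledKernel_mul_scaledKernel {h : ℝ} (hh : 0 < h) (x y : ℝ) :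
    Integrable fun u => KDE.scaledKernel h (u - x) * KDE.scaledKernel h (u - y) := by
  simp only [KDE.scaledKernel_mul_scaledKernel hh]
  exact ((integrable_exp_neg_mul_sq (b := 1 / h ^ 2) (by positivity)).comp_sub_right _).const_mul _

theorem KDE.integral_scaledKernel_mul_scaledKernel {h : ℝ} (hh : 0 < h) (x y : ℝ) :
    ∫ u, KDE.scaledKernel h (u - x) * KDE.scaledKernel h (u - y) =
      1 / h * (1 / (2 * Real.sqrt Real.pi)) * Real.exp (-(x - y) ^ 2 / (4 * h ^ 2)) := by
  simp only [KDE.scaledKernel_mul_scaledKernel hh]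
  rw [integral_const_mul,
    integral_sub_right_eq_self (fun u => Real.exp (-(1 / h ^ 2) * u ^ 2)), integral_gaussian]
  have : Real.sqrt (Real.pi / (1 / h ^ 2)) = h * Real.sqrt Real.pi := by
    rw [show Real.pi / (1 / h ^ 2) = h ^ 2 * Real.pi by field_simp,
      Real.sqrt_mul (by positivity), Real.sqrt_sq hh.le]
  rw [this]
  have hpi : Real.sqrt Real.pi * Real.sqrt Real.pi = Real.pi := Real.mul_self_sqrt Real.pi_pos.le
  have hne : Real.sqrt Real.pi ≠ 0 := by positivity
  rw [show 2 * Real.pi * h ^ 2 = 2 * (√Real.pi * √Real.pi) * h ^ 2 by rw [hpi]]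
  field_simp

/-! ### Variance and covariance of the estimator -/

/-- For a bounded continuous square integrable `φ`, the variance of the empirical mean of `φ` over
a uniform sample is at most `∫ φ² / n`. -/
theorem variance_empirical_mean_le {Ω : Type*} [MeasurableSpace Ω] (P : Measure Ω)
    [IsProbabilityMeasure P] {n : ℕ} (hn : 1 ≤ n) (X : Fin n → Ω → ℝ) (hindep : iIndepFun X P)
    (hunif : ∀ i, pdf.IsUniform (X i) (Set.Icc (0 : ℝ) 1) P volume)
    {φ : ℝ → ℝ} (hφ : Continuous φ) {C : ℝ} (hC : ∀ u, |φ u| ≤ C)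
    (hφ2 : Integrable fun u => φ u ^ 2) :
    (n : ℝ) * Var[fun ω => 1 / (n : ℝ) * ∑ k, φ (X k ω); P] ≤ ∫ u, φ u ^ 2 := by
  have hX : ∀ k, AEMeasurable (X k) P := fun k => (hunif k).aemeasurable (by simp) (by simp)
  have hmem : ∀ k, MemLp (fun ω => φ (X k ω)) 2 P := fun k =>
    MemLp.of_bound (hφ.measurable.comp_aemeasurable (hX k)).aestronglyMeasurable C
      (Filter.Eventually.of_forall fun ω => hC _)
  have hvar : ∀ k, Var[fun ω => φ (X k ω); P] ≤ ∫ u, φ u ^ 2 := by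
    intro k
    refine (variance_le_expectation_sq (hmem k).aestronglyMeasurable).trans ?_
    have hmap : P.map (X k) = volume.restrict (Set.Icc (0 : ℝ) 1) := by
      rw [hunif k, ProbabilityTheory.cond]; simp
    calc ∫ ω, ((fun ω => φ (X k ω)) ^ 2) ω ∂P = ∫ u, φ u ^ 2 ∂(P.map (X k)) :=
          (integral_map (hX k) (hφ.pow 2).aestronglyMeasurable).symm
      _ = ∫ u in Set.Icc (0 : ℝ) 1, φ u ^ 2 := by rw [hmap]
      _ ≤ _ := setIntegral_le_integral hφ2 (Filter.Eventually.of_forall fun u => sq_nonneg _)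
  have hsum : Var[fun ω => ∑ k, φ (X k ω); P] = ∑ k, Var[fun ω => φ (X k ω); P] := by
    have := IndepFun.variance_sum (s := Finset.univ) (X := fun k ω => φ (X k ω)) (μ := P)
      (fun k _ => hmem k)
      (fun i _ j _ hij => (hindep.indepFun hij).comp hφ.measurable hφ.measurable)
    rw [← this]; congr 1; ext ω; simp
  have hn0 : (0 : ℝ) < n := by exact_mod_cast hn
  rw [variance_const_mul, hsum]
  calc (n : ℝ) * ((1 / (n : ℝ)) ^ 2 * ∑ k, Var[fun ω => φ (X k ω); P])
      ≤ (n : ℝ) * ((1 / (n : ℝ)) ^ 2 * ∑ _k : Fin n, ∫ u, φ u ^ 2) := by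
        gcongr with k _; exact hvar k
    _ = _ := by simp; field_simp

/-- The quadratic form of the scaled covariance matrix is dominated by that of the Gaussian kernel
matrix. -/
theorem KDE.scaledCov_form_le {Ω : Type*} [MeasurableSpace Ω] (P : Measure Ω)
    [IsProbabilityMeasure P] {n : ℕ} (hn : 1 ≤ n) (X : Fin n → Ω → ℝ) (hindep : iIndepFun X P)
    (hunif : ∀ i, pdf.IsUniform (X i) (Set.Icc (0 : ℝ) 1) P volume) {h : ℝ} (hh : 0 < h)
    (a δ : ℝ) (v : Fin (KDE.meshSize a δ) → ℝ) :
    ∑ i, ∑ j, v i * v j * KDE.scaledCov P X h a δ i j ≤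
      1 / (2 * Real.sqrt Real.pi) * ∑ i, ∑ j, v i * v j *
        Real.exp (-(δ ^ 2 / (4 * h ^ 2)) * (((i : ℕ) : ℝ) - ((j : ℕ) : ℝ)) ^ 2) := by
  set x := KDE.meshPoint a δ with hx
  set φ : ℝ → ℝ := fun u => ∑ i, v i * KDE.scaledKernel h (u - x i) with hφ
  have hφc : Continuous φ := continuous_finsetSum _ fun i _ =>
    continuous_const.mul ((KDE.continuous_scaledKernel h).comp (continuous_id.sub continuous_const))
  have hφb : ∀ u, |φ u| ≤ ∑ i, |v i| * (|1 / h| * (1 / Real.sqrt (2 * Real.pi))) := fun u =>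
    (Finset.abs_sum_le_sum_abs _ _).trans (Finset.sum_le_sum fun i _ => by
      rw [abs_mul]; gcongr; exact KDE.abs_scaledKernel_le h _)
  have hφ2 : ∀ u, φ u ^ 2 = ∑ i, ∑ j, v i * v j *
      (KDE.scaledKernel h (u - x i) * KDE.scaledKernel h (u - x j)) := by
    intro u
    rw [sq, hφ, Finset.sum_mul_sum]
    exact Finset.sum_congr rfl fun i _ => Finset.sum_congr rfl fun j _ => by ring
  have hint : ∀ i j, Integrable fun u => v i * v j *
      (KDE.scaledKernel h (u - x i) * KDE.scaledKernel h (u - x j)) := fun i j =>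
    (KDE.integrable_scaledKernel_mul_scaledKernel hh _ _).const_mul _
  have hφ2int : Integrable fun u => φ u ^ 2 := by
    simp only [hφ2]
    exact integrable_finsetSum _ fun i _ => integrable_finsetSum _ fun j _ => hint i j
  have hX : ∀ k, AEMeasurable (X k) P := fun k => (hunif k).aemeasurable (by simp) (by simp)
  have hkde : ∀ y, MemLp (KDE.kde X h y) 2 P := fun y =>
    (memLp_finsetSum (f := fun k ω => KDE.scaledKernel h (X k ω - y)) Finset.univ fun k _ =>
      MemLp.of_bound ((KDE.continuous_scaledKernel h).measurable.comp_aemeasurable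
        ((hX k).sub_const y)).aestronglyMeasurable _
        (Filter.Eventually.of_forall fun ω => KDE.abs_scaledKernel_le h _)).const_mul _
  have hcov : ∀ y z, cov[KDE.centeredKde P X h y, KDE.centeredKde P X h z; P] =
      cov[KDE.kde X h y, KDE.kde X h z; P] := by
    intro y z
    have hz : Integrable (KDE.centeredKde P X h z) P :=
      ((hkde z).integrable one_le_two).sub (integrable_const _)
    unfold KDE.centeredKde
    rw [covariance_sub_const_left ((hkde y).integrable one_le_two),
      covariance_sub_const_right ((hkde z).integrable one_le_two)]
  have hform : ∑ i, ∑ j, v i * v j * KDE.scaledCov P X h a δ i j =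
      h * (n * Var[fun ω => 1 / (n : ℝ) * ∑ k, φ (X k ω); P]) := by
    have hlin : (fun ω => 1 / (n : ℝ) * ∑ k, φ (X k ω)) =
        fun ω => ∑ i, v i * KDE.kde X h (x i) ω := by
      ext ω
      simp only [hφ, KDE.kde, Finset.mul_sum]
      rw [Finset.sum_comm]
      exact Finset.sum_congr rfl fun i _ => Finset.sum_congr rfl fun j _ => by ring
    rw [hlin, variance_fun_sum fun i => (hkde (x i)).const_mul (v i), Finset.mul_sum, Finset.mul_sum]
    refine Finset.sum_congr rfl fun i _ => ?_
    rw [Finset.mul_sum, Finset.mul_sum]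
    refine Finset.sum_congr rfl fun j _ => ?_
    rw [covariance_const_mul_left, covariance_const_mul_right, KDE.scaledCov, Matrix.of_apply, hcov]
    ring
  rw [hform]
  calc _ ≤ h * ∫ u, φ u ^ 2 := by
        gcongr
        exact variance_empirical_mean_le P hn X hindep hunif hφc hφb hφ2int
    _ = _ := by
        simp only [hφ2]
        rw [integral_finsetSum _ fun i _ => integrable_finsetSum _ fun j _ => hint i j,
          Finset.mul_sum, Finset.mul_sum]
        refine Finset.sum_congr rfl fun i _ => ?_
        rw [integral_finsetSum _ fun j _ => hint i j, Finset.mul_sum, Finset.mul_sum]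
        refine Finset.sum_congr rfl fun j _ => ?_
        rw [integral_const_mul, KDE.integral_scaledKernel_mul_scaledKernel hh]
        have : -(x i - x j) ^ 2 / (4 * h ^ 2) =
            -(δ ^ 2 / (4 * h ^ 2)) * (((i : ℕ) : ℝ) - ((j : ℕ) : ℝ)) ^ 2 := by
          rw [hx, KDE.meshPoint, KDE.meshPoint]; ring
        rw [this]
        field_simp

theorem KDE.scaledCov_isHermitian {Ω : Type*} [MeasurableSpace Ω] (P : Measure Ω) {n : ℕ}
    (X : Fin n → Ω → ℝ) (h a δ : ℝ) : (KDE.scaledCov P X h a δ).IsHermitian := by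
  refine Matrix.IsHermitian.ext fun i j => ?_
  simp only [KDE.scaledCov, Matrix.of_apply, star_trivial]
  rw [covariance_comm]

/-! ### The eigenvalue bound -/

theorem lemma1 {Ω : Type*} [MeasurableSpace Ω] (P : Measure Ω) [IsProbabilityMeasure P]
    (n : ℕ) (hn : 1 ≤ n) (X : Fin n → Ω → ℝ)
    (hindep : iIndepFun X P)
    (hunif : ∀ i, pdf.IsUniform (X i) (Set.Icc (0 : ℝ) 1) P volume)
    (h : ℝ) (hh : h ∈ Set.Ioc (0 : ℝ) 1)
    (a : ℝ) (ha : a ∈ Set.Ioc (0 : ℝ) (1 / 4))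
    (δ : ℝ) (hδ : δ ∈ Set.Ioo (0 : ℝ) (1 / 2)) :
    ∃ lamMin : ℝ, KDE.IsMinEigenvalue (KDE.scaledCov P X h a δ) lamMin ∧
      lamMin ≤ 2 * Real.exp (-(h ^ 2 / δ ^ 2))
        + h / (Real.pi * a * δ) * Real.exp (-(a ^ 2 / h ^ 2)) := by
  obtain ⟨hh0, -⟩ := hh
  obtain ⟨ha0, ha1⟩ := ha
  obtain ⟨hδ0, hδ1⟩ := hδ
  -- From `δ < 1/2 ≤ 1 - 2a`; hence at least two mesh points, so `m ≥ 1`.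
  have hpos : (1 : ℝ) ≤ (1 - 2 * a) / δ := by rw [le_div_iff₀ hδ0]; linarith
  have hN2 : 2 ≤ KDE.meshSize a δ := Nat.le_floor (by push_cast; linarith)
  have hNa : (1 - 2 * a) / δ < KDE.meshSize a δ := by
    have := Nat.lt_floor_add_one (1 + (1 - 2 * a) / δ)
    unfold KDE.meshSize
    linarith
  obtain ⟨m, hm⟩ : ∃ m, KDE.meshSize a δ = m + 1 := ⟨KDE.meshSize a δ - 1, by omega⟩
  obtain ⟨v, hv, hform⟩ := exists_gaussian_toeplitz_form_eq (δ ^ 2 / (4 * h ^ 2)) m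
  -- Since `a ≤ 1/4`, `2a ≤ 1 - 2a < N δ`.
  have hNa' : 2 * a ≤ (m + 1) * δ := by
    rw [hm, div_lt_iff₀ hδ0] at hNa
    push_cast at hNa
    linarith
  refine exists_isMinEigenvalue_le (KDE.scaledCov_isHermitian P X h a δ)
    (fun i => v i) ⟨m, by omega⟩ hv (by positivity) ?_
  refine (KDE.scaledCov_form_le P hn X hindep hunif hh0 a δ _).trans ?_
  have hsum : ∑ i : Fin (KDE.meshSize a δ), ∑ j : Fin (KDE.meshSize a δ), v i * v j *
        Real.exp (-(δ ^ 2 / (4 * h ^ 2)) * (((i : ℕ) : ℝ) - ((j : ℕ) : ℝ)) ^ 2) =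
      ∏ k ∈ Finset.range m, (1 - Real.exp (-(1 / (2 * (h / δ) ^ 2) * ((k : ℝ) + 1)))) := by
    have hc : 1 / (2 * (h / δ) ^ 2) = 2 * (δ ^ 2 / (4 * h ^ 2)) := by field_simp; norm_num
    rw [hc, ← hform, ← hm, Finset.sum_range]
    exact Finset.sum_congr rfl fun i _ => (Finset.sum_range fun j => v i * v j *
      Real.exp (-(δ ^ 2 / (4 * h ^ 2)) * (((i : ℕ) : ℝ) - (j : ℝ)) ^ 2)).symm
  rw [hsum]
  refine (half_inv_sqrt_pi_mul_prod_le (s := a / h) (b := a) (div_pos hh0 hδ0) (by omega) ha0 ha1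
    (by positivity) ?_).trans_eq ?_
  · rw [show 2 * (a / h) * (h / δ) = 2 * a / δ by field_simp, div_le_iff₀ hδ0]
    exact hNa'
  · rw [div_pow, div_pow, show h / δ / (Real.pi * a) = h / (Real.pi * a * δ) by field_simp]
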